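/- For a finite simple graph $G$ let $$AZI(G)=\sum_{uv\in E(G)}\left(\frac{d_ud_v}{d_u+d_v-2}\right)^{3},$$ where $d_u$ denotes the degree of the vertex $u$. A path $v_1v_2\cdots v_{l+1}$ of length $l$ in $G$ is called internal if $d_{v_1}>2$, $d_{v_{l+1}}>2$, and $d_{v_i}=2$ for all $2\le i\le l$; it is called pendent if one of $d_{v_1},d_{v_{l+1}}$ equals $1$, the other is greater than $2$, and $d_{v_i}=2$ for all $2\le i\le l$. Theorem 2. Let $n\ge 10$, and let $T^*$ be a tree on $n$ vertices whose $AZI$ is maximum among all trees on $n$ vertices. Then: (1) $T^*$ contains no internal path of length $l\ge 2$; (2) $T^*$ contains no pendent path of length $l\ge 4$; (3) $T^*$ contains at most one pendent path of length $3$ (a path and its reversal being the same path). -/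

import Mathlib

/-- The contribution `(x y / (x + y - 2))³` of an edge whose ends have degrees `x` and `y`. -/
noncomputable def aziWeight (x y : ℝ) : ℝ := (x * y / (x + y - 2)) ^ 3

theorem aziWeight_comm (x y : ℝ) : aziWeight x y = aziWeight y x := by
  simp only [aziWeight, mul_comm x y, add_comm x y]

namespace SimpleGraph

variable {V : Type*} [Fintype V]

open Classical in
/-- The augmented Zagreb index
`AZI(G) = ∑_{uv ∈ E(G)} (d_u d_v / (d_u + d_v - 2))³` of a finite simple graph. -/
noncomputable def azi (G : SimpleGraph V) : ℝ :=
  ∑ e ∈ G.edgeFinset,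
    Sym2.lift ⟨fun u v => aziWeight (G.degree u) (G.degree v),
      fun _ _ => aziWeight_comm _ _⟩ e

/-- `T` is a tree, and its `AZI` is maximum among all trees with the same number of vertices
(up to isomorphism these are the trees on the vertex type of `T`). -/
def IsMaxAziTree (T : SimpleGraph V) : Prop :=
  T.IsTree ∧ ∀ T' : SimpleGraph V, T'.IsTree → azi T' ≤ azi T

open Classical in
/-- A path is internal if both of its ends have degree greater than 2 and all of its inner
vertices have degree 2. -/
def IsInternalPath {G : SimpleGraph V} {u v : V} (p : G.Walk u v) : Prop :=
  p.IsPath ∧ 2 < G.degree u ∧ 2 < G.degree v ∧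
    ∀ i, 0 < i → i < p.length → G.degree (p.getVert i) = 2

open Classical in
/-- A path is pendent if one of its ends has degree 1, the other has degree greater than 2,
and all of its inner vertices have degree 2. -/
def IsPendentPath {G : SimpleGraph V} {u v : V} (p : G.Walk u v) : Prop :=
  p.IsPath ∧
    (G.degree u = 1 ∧ 2 < G.degree v ∨ 2 < G.degree u ∧ G.degree v = 1) ∧
    ∀ i, 0 < i → i < p.length → G.degree (p.getVert i) = 2

end SimpleGraph

/-!
An edge with an end of degree `2` has weight exactly `8`, a pendent edge has weight at most `8`, and
an edge between two branching vertices has weight greater than `8`, increasing in both degrees.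
Every claim follows by moving ends of edges without disconnecting the tree.

An internal path of length at least `2` can be replaced by the edge joining its ends, and its inner
vertices hung from a leaf: no surviving edge loses weight, and the new edge weighs more than `8`.
Hanging both ends of the path on `n ≥ 10` vertices from two adjacent inner vertices beats its weight
`8 (n - 1)`, so a maximal tree has two adjacent branching vertices `x` and `y`. If it had a leaf
followed by three vertices of degree `2`, hanging the first two vertices of this tail from `x` would
increase the weight of `xy`. Finally, if there were two pendent paths of length `3`, moving the leaf
of one to the leaf of the other would not decrease the index and would create such a tail.
-/

namespace AugmentedZagreb

open SimpleGraph

section Weight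

theorem aziWeight_le_aziWeight {x x' y : ℝ} (hx : 0 < x) (hxx' : x ≤ x') (hy : 2 ≤ y) :
    aziWeight x y ≤ aziWeight x' y := by
  have hpos : 0 < x + y - 2 := by linarith
  refine pow_le_pow_left₀ (div_nonneg (by positivity) hpos.le) ?_ 3
  rw [div_le_div_iff₀ hpos (by linarith)]
  nlinarith [mul_nonneg (sub_nonneg.2 hxx') (mul_nonneg (by linarith : 0 ≤ y) (sub_nonneg.2 hy))]

theorem aziWeight_lt_aziWeight {x x' y : ℝ} (hx : 0 < x) (hxx' : x < x') (hy : 2 < y) :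
    aziWeight x y < aziWeight x' y := by
  have hpos : 0 < x + y - 2 := by linarith
  refine pow_lt_pow_left₀ ?_ (div_nonneg (by positivity) hpos.le) three_ne_zero
  rw [div_lt_div_iff₀ hpos (by linarith)]
  nlinarith [mul_pos (sub_pos.2 hxx') (mul_pos (by linarith : 0 < y) (sub_pos.2 hy))]

theorem aziWeight_two_left {y : ℝ} (hy : y ≠ 0) : aziWeight 2 y = 8 := by
  rw [aziWeight, add_sub_cancel_left, mul_div_cancel_right₀ _ hy]
  norm_num

theorem aziWeight_two_right {x : ℝ} (hx : x ≠ 0) : aziWeight x 2 = 8 := by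
  rw [aziWeight_comm, aziWeight_two_left hx]

theorem eight_lt_aziWeight {x y : ℝ} (hx : 2 < x) (hy : 2 < y) : 8 < aziWeight x y := by
  rw [← aziWeight_two_left (by linarith : y ≠ 0)]
  exact aziWeight_lt_aziWeight two_pos hx hy

theorem aziWeight_one_left_lt {y : ℝ} (hy : 2 < y) : aziWeight 1 y < 8 := by
  rw [← aziWeight_two_left (by linarith : y ≠ 0)]
  exact aziWeight_lt_aziWeight one_pos one_lt_two hy

-- For `d = 1` the denominator vanishes, so the weight of an isolated edge is the junk value `0`.
theorem aziWeight_one_left_le (d : ℕ) : aziWeight 1 d ≤ 8 := by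
  rcases lt_or_ge d 2 with hd | hd
  · interval_cases d <;> norm_num [aziWeight]
  · have hd : (2 : ℝ) ≤ d := mod_cast hd
    rw [← aziWeight_two_left (by linarith : (d : ℝ) ≠ 0)]
    exact aziWeight_le_aziWeight one_pos one_le_two hd

end Weight

/-- The contribution of an edge to the augmented Zagreb index when the vertex degrees are
prescribed by `d`; it allows the edges of one graph to be weighted by the degrees of another. -/
noncomputable def edgeWeight {V : Type*} (d : V → ℕ) : Sym2 V → ℝ :=
  Sym2.lift ⟨fun u v => aziWeight (d u) (d v), fun _ _ => aziWeight_comm _ _⟩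

theorem edgeWeight_mk {V : Type*} (d : V → ℕ) (u v : V) :
    edgeWeight d s(u, v) = aziWeight (d u) (d v) := rfl

open scoped Classical

section Sum

variable {V : Type*} [Fintype V] {G G' : SimpleGraph V}

theorem azi_eq_sum_edgeWeight (G : SimpleGraph V) :
    azi G = ∑ e ∈ G.edgeFinset, edgeWeight (G.degree ·) e := rfl

theorem azi_add_sum_le {A B : Finset (Sym2 V)} (hA : A ⊆ G.edgeFinset)
    (hB : Disjoint (G.edgeFinset \ A) B) (hE : G'.edgeFinset = G.edgeFinset \ A ∪ B)
    (hle : ∀ p q, G.Adj p q → s(p, q) ∉ A → G'.degree p ≠ G.degree p →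
      aziWeight (G.degree p) (G.degree q) ≤ aziWeight (G'.degree p) (G'.degree q)) :
    azi G + ∑ e ∈ B, edgeWeight (G'.degree ·) e ≤
      azi G' + ∑ e ∈ A, edgeWeight (G.degree ·) e := by
  have hkept : ∑ e ∈ G.edgeFinset \ A, edgeWeight (G.degree ·) e ≤
      ∑ e ∈ G.edgeFinset \ A, edgeWeight (G'.degree ·) e := by
    refine Finset.sum_le_sum fun e he => ?_
    induction e with | h p q => ?_
    rw [Finset.mem_sdiff, mem_edgeFinset, mem_edgeSet] at he
    rw [edgeWeight_mk, edgeWeight_mk]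
    by_cases hp : G'.degree p = G.degree p
    · by_cases hq : G'.degree q = G.degree q
      · rw [hp, hq]
      · rw [aziWeight_comm, aziWeight_comm (G'.degree p)]
        exact hle q p he.1.symm (Sym2.eq_swap ▸ he.2) hq
    · exact hle p q he.1 he.2 hp
  rw [azi_eq_sum_edgeWeight G, azi_eq_sum_edgeWeight G', hE, Finset.sum_union hB,
    ← Finset.sum_sdiff hA]
  linarith

theorem aziWeight_degree_two_left {p q : V} (hpq : G.Adj p q) (hp : G.degree p = 2) :
    aziWeight (G.degree p) (G.degree q) = 8 := by
  rw [hp, Nat.cast_ofNat, aziWeight_two_left (mod_cast hpq.degree_pos_right.ne')]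

theorem aziWeight_degree_two_right {p q : V} (hpq : G.Adj p q) (hq : G.degree q = 2) :
    aziWeight (G.degree p) (G.degree q) = 8 := by
  rw [aziWeight_comm, aziWeight_degree_two_left hpq.symm hq]

theorem aziWeight_degree_le_eight {p q : V} (hpq : G.Adj p q) (hp : G.degree p ≤ 2) :
    aziWeight (G.degree p) (G.degree q) ≤ 8 := by
  have hpos := hpq.degree_pos_left
  interval_cases G.degree p
  · exact_mod_cast aziWeight_one_left_le _
  · rw [Nat.cast_ofNat, aziWeight_two_left (mod_cast hpq.degree_pos_right.ne')]

end Sum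

section Neighbor

variable {V : Type*} {G : SimpleGraph V} {a b c q : V}

theorem eq_of_adj_of_degree_eq_one [Fintype (G.neighborSet a)] (ha : G.degree a = 1)
    (hb : G.Adj a b) (hq : G.Adj a q) : q = b :=
  (degree_eq_one_iff_existsUnique_adj.1 ha).unique hq hb

theorem eq_or_eq_of_adj_of_degree_eq_two [Fintype (G.neighborSet a)] (ha : G.degree a = 2)
    (hb : G.Adj a b) (hc : G.Adj a c) (hbc : b ≠ c) (hq : G.Adj a q) : q = b ∨ q = c := by
  have hsub : {b, c} ⊆ G.neighborFinset a := by
    simp [Finset.insert_subset_iff, hb, hc]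
  have hN : {b, c} = G.neighborFinset a :=
    Finset.eq_of_subset_of_card_le hsub <| by
      rw [card_neighborFinset_eq_degree, ha, Finset.card_pair hbc]
  have hmem : q ∈ ({b, c} : Finset V) := hN ▸ (mem_neighborFinset G a q).2 hq
  simpa using hmem

end Neighbor

section Slide

variable {V : Type*} {G : SimpleGraph V} {b c x : V}

/-- The graph obtained from `G` by moving the end `c` of the edge `bc` to `x`. When `bc` is a bridge
of a tree, this is the regrafting of a branch at `x`. -/
def slide (G : SimpleGraph V) (b c x : V) : SimpleGraph V :=
  G.deleteEdges {s(b, c)} ⊔ edge b x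

theorem slide_adj {p q : V} : (slide G b c x).Adj p q ↔
    G.Adj p q ∧ s(p, q) ≠ s(b, c) ∨ s(p, q) = s(b, x) ∧ p ≠ q := by
  simp [slide, edge_adj]

theorem slide_adj_of_ne {p q : V} (hp : p ≠ b) (hq : q ≠ b) :
    (slide G b c x).Adj p q ↔ G.Adj p q := by
  simp [slide_adj, hp, hq]

theorem reachable_deleteEdges_of_cut (hG : G.Connected) (S : Set V)
    (hS : ∀ p ∈ S, ∀ q ∉ S, G.Adj p q → p = b ∧ q = c) (hb : b ∈ S) (hx : x ∉ S) :
    (G.deleteEdges {s(b, c)}).Reachable x c := by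
  obtain ⟨w⟩ := hG.preconnected x b
  induction w with
  | nil => exact absurd hb hx
  | @cons x y _ hxy _ ih =>
    by_cases hy : y ∈ S
    · rw [(hS y hy x hx hxy.symm).2]
    · refine Reachable.trans (Adj.reachable ?_) (ih hS hb hy)
      rw [deleteEdges_adj, Set.mem_singleton_iff, Sym2.eq_iff]
      exact ⟨hxy, by rintro (⟨rfl, -⟩ | ⟨-, rfl⟩) <;> contradiction⟩

theorem reachable_deleteEdges_snd {u w : V} {p : G.Walk u w} (hp : p.IsPath)
    (hnil : ¬ p.Nil) : (G.deleteEdges {s(u, p.snd)}).Reachable w p.snd := by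
  cases p with
  | nil => exact absurd .nil hnil
  | cons h p =>
    rw [Walk.snd_cons]
    refine ((p.toDeleteEdge _ fun he => ?_).reachable).symm
    exact ((Walk.cons_isPath_iff h p).1 hp).2 (p.fst_mem_support_of_mem_edges he)

theorem not_reachable_deleteEdges (hG : G.IsAcyclic) (hbc : G.Adj b c)
    (hx : (G.deleteEdges {s(b, c)}).Reachable x c) :
    ¬ (G.deleteEdges {s(b, c)}).Reachable b x := fun h =>
  isAcyclic_iff_forall_adj_isBridge.1 hG hbc (h.trans hx)

theorem not_adj_of_reachable_deleteEdges (hG : G.IsAcyclic) (hbc : G.Adj b c) (hxc : x ≠ c)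
    (hx : (G.deleteEdges {s(b, c)}).Reachable x c) : ¬ G.Adj b x := fun h =>
  not_reachable_deleteEdges hG hbc hx <| Adj.reachable <| by
    rw [deleteEdges_adj, Set.mem_singleton_iff, Sym2.congr_right]
    exact ⟨h, hxc⟩

theorem isTree_slide (hG : G.IsTree) (hbc : G.Adj b c)
    (hx : (G.deleteEdges {s(b, c)}).Reachable x c) : (slide G b c x).IsTree := by
  have hbx := not_reachable_deleteEdges hG.isAcyclic hbc hx
  have hne : b ≠ x := by rintro rfl; exact hbx .rfl
  have hreach : (slide G b c x).Reachable b c :=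
    (Adj.reachable (slide_adj.2 (.inr ⟨rfl, hne⟩))).trans (hx.mono le_sup_left)
  have hadj : ∀ p q, G.Adj p q → (slide G b c x).Reachable p q := by
    intro p q hpq
    by_cases h : s(p, q) = s(b, c)
    · obtain ⟨rfl, rfl⟩ | ⟨rfl, rfl⟩ := Sym2.eq_iff.1 h
      exacts [hreach, hreach.symm]
    · exact Adj.reachable (slide_adj.2 (.inl ⟨hpq, h⟩))
  have := hG.connected.nonempty
  refine ⟨⟨fun u v => ?_⟩, (hG.isAcyclic.anti (deleteEdges_le _)).sup_edge_of_not_reachable hbx⟩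
  obtain ⟨w⟩ := hG.connected.preconnected u v
  induction w with
  | nil => rfl
  | cons h _ ih => exact (hadj _ _ h).trans ih

variable [Fintype V]

theorem edgeFinset_slide (hbx : b ≠ x) :
    (slide G b c x).edgeFinset = G.edgeFinset \ {s(b, c)} ∪ {s(b, x)} := by
  ext e
  induction e with | h p q => ?_
  simp only [mem_edgeFinset, mem_edgeSet, slide_adj, Finset.mem_union, Finset.mem_sdiff,
    Finset.mem_singleton]
  grind

theorem degree_eq_sum_edgeFinset (G : SimpleGraph V) (v : V) :
    G.degree v = ∑ e ∈ G.edgeFinset, if v ∈ e then 1 else 0 := by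
  rw [← card_incidenceFinset_eq_degree, incidenceFinset_eq_filter, Finset.card_filter]

theorem degree_slide_add (hbc : G.Adj b c) (hbx : b ≠ x) (hbx' : ¬ G.Adj b x) (v : V) :
    (slide G b c x).degree v + (if v ∈ s(b, c) then 1 else 0) =
      G.degree v + if v ∈ s(b, x) then 1 else 0 := by
  have hdisj : Disjoint (G.edgeFinset \ {s(b, c)}) {s(b, x)} := by simp [hbx']
  have hsub : {s(b, c)} ⊆ G.edgeFinset := by simpa using hbc
  rw [degree_eq_sum_edgeFinset, degree_eq_sum_edgeFinset, edgeFinset_slide hbx,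
    Finset.sum_union hdisj, ← Finset.sum_sdiff hsub, Finset.sum_singleton, Finset.sum_singleton]
  exact add_right_comm ..

theorem degree_slide_old_add_one (hbc : G.Adj b c) (hbx : b ≠ x) (hbx' : ¬ G.Adj b x) :
    (slide G b c x).degree c + 1 = G.degree c := by
  have hcx : c ≠ x := by rintro rfl; exact hbx' hbc
  simpa [hbc.ne', hcx] using degree_slide_add hbc hbx hbx' c

theorem degree_slide_new (hbc : G.Adj b c) (hbx : b ≠ x) (hbx' : ¬ G.Adj b x) :
    (slide G b c x).degree x = G.degree x + 1 := by
  have hcx : c ≠ x := by rintro rfl; exact hbx' hbc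
  simpa [hbx.symm, hcx.symm] using degree_slide_add hbc hbx hbx' x

theorem degree_slide_of_ne (hbc : G.Adj b c) (hbx : b ≠ x) (hbx' : ¬ G.Adj b x) {v : V}
    (hvc : v ≠ c) (hvx : v ≠ x) : (slide G b c x).degree v = G.degree v := by
  simpa [hvc, hvx] using degree_slide_add hbc hbx hbx' v

theorem azi_add_le_azi_slide {y : V} (hbc : G.Adj b c) (hbx : b ≠ x) (hbx' : ¬ G.Adj b x)
    (hcx : ¬ G.Adj c x) (hxy : G.Adj x y)
    (hc : ∀ q, G.Adj c q → q ≠ b →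
      aziWeight (G.degree c) (G.degree q) ≤ aziWeight (G.degree c - 1) (G.degree q))
    (hx : ∀ q, G.Adj x q → q ≠ y →
      aziWeight (G.degree x) (G.degree q) ≤ aziWeight (G.degree x + 1) (G.degree q)) :
    azi G + (aziWeight (G.degree b) (G.degree x + 1) + aziWeight (G.degree x + 1) (G.degree y)) ≤
      azi (slide G b c x) +
        (aziWeight (G.degree b) (G.degree c) + aziWeight (G.degree x) (G.degree y)) := by
  have hcx' : c ≠ x := by rintro rfl; exact hbx' hbc
  have hyc : y ≠ c := by rintro rfl; exact hcx hxy.symm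
  have hyb : y ≠ b := by rintro rfl; exact hbx' hxy.symm
  have hdc : ((slide G b c x).degree c : ℝ) = G.degree c - 1 :=
    eq_sub_of_add_eq (mod_cast degree_slide_old_add_one hbc hbx hbx')
  have hdx : ((slide G b c x).degree x : ℝ) = G.degree x + 1 :=
    mod_cast degree_slide_new hbc hbx hbx'
  have hd {v : V} (hvc : v ≠ c) (hvx : v ≠ x) := degree_slide_of_ne hbc hbx hbx' hvc hvx
  have h := azi_add_sum_le (G := G) (G' := slide G b c x) (A := {s(b, c), s(x, y)})
    (B := {s(b, x), s(x, y)}) ?_ ?_ ?_ ?_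
  · rw [Finset.sum_pair, Finset.sum_pair] at h
    · simp only [edgeWeight_mk, hdx, hd hbc.ne hbx, hd hyc hxy.ne'] at h
      exact h
    · grind
    · grind
  · simp [Finset.insert_subset_iff, hbc, hxy]
  · simp [hbx', hxy]
  · rw [edgeFinset_slide hbx]
    grind [mem_edgeFinset, mem_edgeSet]
  · intro p q hpq hA hne
    have hp : p = c ∨ p = x := by
      by_contra! hp
      exact hne (hd hp.1 hp.2)
    rcases hp with rfl | rfl
    · have hqx : q ≠ x := by rintro rfl; exact hcx hpq
      rw [hdc, hd hpq.ne' hqx]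
      exact hc q hpq fun hqb => hA (by simp [hqb])
    · have hqc : q ≠ c := by rintro rfl; exact hcx hpq.symm
      rw [hdx, hd hqc hpq.ne']
      exact hx q hpq fun hqy => hA (by simp [hqy])

end Slide

section Tail

variable {V : Type*} [Fintype V] {T : SimpleGraph V} {a b c d x y z : V}

/-- The vertices `a`, `b`, `c` start a tail of `G`: a leaf followed by two vertices of
degree `2`. -/
structure IsTail (G : SimpleGraph V) (a b c : V) : Prop where
  adj_ab : G.Adj a b
  adj_bc : G.Adj b c
  degree_a : G.degree a = 1
  degree_b : G.degree b = 2
  degree_c : G.degree c = 2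

/-- A tail whose leaf is followed by at least three vertices `b`, `c`, `d` of degree `2`. -/
structure IsLongTail (G : SimpleGraph V) (a b c d : V) : Prop extends IsTail G a b c where
  adj_cd : G.Adj c d
  b_ne_d : b ≠ d
  degree_d : G.degree d = 2

theorem IsTail.a_ne_c (h : IsTail T a b c) : a ≠ c := by
  rintro rfl
  exact absurd (h.degree_a.symm.trans h.degree_c) (by decide)

theorem IsTail.eq_of_adj_a (h : IsTail T a b c) (hq : T.Adj a x) : x = b :=
  eq_of_adj_of_degree_eq_one h.degree_a h.adj_ab hq

theorem IsTail.eq_or_eq_of_adj_b (h : IsTail T a b c) (hq : T.Adj b x) : x = a ∨ x = c :=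
  eq_or_eq_of_adj_of_degree_eq_two h.degree_b h.adj_ab.symm h.adj_bc h.a_ne_c hq

theorem IsLongTail.eq_or_eq_of_adj_c (h : IsLongTail T a b c d) (hq : T.Adj c x) :
    x = b ∨ x = d :=
  eq_or_eq_of_adj_of_degree_eq_two h.degree_c h.adj_bc.symm h.adj_cd h.b_ne_d hq

theorem IsTail.isTree_slide (h : IsTail T a b c) (hT : T.IsTree) (hya : y ≠ a) :
    (slide T a b y).IsTree := by
  refine AugmentedZagreb.isTree_slide hT h.adj_ab
    (reachable_deleteEdges_of_cut hT.connected {a} ?_ rfl hya)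
  rintro p rfl q - hq
  exact ⟨rfl, h.eq_of_adj_a hq⟩

theorem IsTail.azi_add_eight_le_azi_slide (h : IsTail T a b c) (hy : T.degree y = 1)
    (hya : y ≠ a) (hyz : T.Adj y z) :
    azi T + 8 ≤ azi (slide T a b y) + aziWeight 1 (T.degree z) := by
  have hay : ¬ T.Adj a y := by
    intro hay
    rw [h.eq_of_adj_a hay, h.degree_b] at hy
    contradiction
  have hby : ¬ T.Adj b y := by
    intro hby
    rw [(h.eq_or_eq_of_adj_b hby).resolve_left hya, h.degree_c] at hy
    contradiction
  have hslide := azi_add_le_azi_slide h.adj_ab hya.symm hay hby hyz ?_ ?_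
  · simp only [h.degree_a, h.degree_b, hy, Nat.cast_one, Nat.cast_ofNat, one_add_one_eq_two,
      aziWeight_two_right one_ne_zero, aziWeight_two_left
        (Nat.cast_ne_zero.2 hyz.degree_pos_right.ne' : (T.degree z : ℝ) ≠ 0)] at hslide
    linarith
  · intro q hq hqa
    rw [(h.eq_or_eq_of_adj_b hq).resolve_left hqa, h.degree_b, h.degree_c]
    norm_num [aziWeight]
  · exact fun q hq hqz => absurd (eq_of_adj_of_degree_eq_one hy hyz hq) hqz

theorem IsLongTail.isTree_slide (h : IsLongTail T a b c d) (hT : T.IsTree) (hxa : x ≠ a)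
    (hxb : x ≠ b) : (slide T b c x).IsTree := by
  refine AugmentedZagreb.isTree_slide hT h.adj_bc
    (reachable_deleteEdges_of_cut hT.connected {a, b} ?_ (by simp) (by simp [hxa, hxb]))
  rintro p (rfl | rfl) q hqS hq
  · exact absurd (h.eq_of_adj_a hq) (by grind)
  · exact ⟨rfl, (h.eq_or_eq_of_adj_b hq).resolve_left (by grind)⟩

theorem IsLongTail.azi_add_le_azi_slide (h : IsLongTail T a b c d)
    (hx : x ∉ ({a, b, c, d} : Set V)) (hxy : T.Adj x y) (hdeg : ∀ q, T.Adj x q → 2 ≤ T.degree q) :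
    azi T + aziWeight (T.degree x + 1) (T.degree y) ≤
      azi (slide T b c x) + aziWeight (T.degree x) (T.degree y) := by
  simp only [Set.mem_insert_iff, Set.mem_singleton_iff, not_or] at hx
  obtain ⟨hxa, hxb, hxc, hxd⟩ := hx
  have hslide := AugmentedZagreb.azi_add_le_azi_slide h.adj_bc (Ne.symm hxb)
    (fun hbx => (h.eq_or_eq_of_adj_b hbx).elim hxa hxc)
    (fun hcx => (h.eq_or_eq_of_adj_c hcx).elim hxb hxd) hxy ?_ ?_
  · rw [h.degree_b, h.degree_c, Nat.cast_ofNat, aziWeight_two_left (by positivity),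
      aziWeight_two_left two_ne_zero] at hslide
    linarith
  · intro q hq hqb
    rw [(h.eq_or_eq_of_adj_c hq).resolve_left hqb, h.degree_c, h.degree_d]
    norm_num [aziWeight]
  · exact fun q hq _ => aziWeight_le_aziWeight (mod_cast hxy.degree_pos_left) (by linarith)
      (mod_cast hdeg q hq)

theorem IsTail.degree_le_two_of_isMaxAziTree (h : IsTail T a b c) (hT : T.IsMaxAziTree)
    (hy : T.degree y = 1) (hyz : T.Adj y z) : T.degree z ≤ 2 := by
  by_cases hya : y = a
  · subst hya
    rw [h.eq_of_adj_a hyz, h.degree_b]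
  · by_contra! hz
    have hmax := hT.2 _ (h.isTree_slide hT.1 hya)
    have hslide := h.azi_add_eight_le_azi_slide hy hya hyz
    have hlt : aziWeight 1 (T.degree z) < 8 := aziWeight_one_left_lt (mod_cast hz)
    linarith

theorem IsTail.isMaxAziTree_slide (h : IsTail T a b c) (hT : T.IsMaxAziTree)
    (hy : T.degree y = 1) (hya : y ≠ a) : (slide T a b y).IsMaxAziTree := by
  obtain ⟨z, hyz⟩ := (degree_pos_iff_exists_adj T y).1 (by omega)
  have hslide := h.azi_add_eight_le_azi_slide hy hya hyz
  have hle := aziWeight_one_left_le (T.degree z)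
  exact ⟨h.isTree_slide hT.1 hya, fun T' hT' => by linarith [hT.2 T' hT']⟩

theorem not_isLongTail_of_adj (hT : T.IsMaxAziTree) (hxy : T.Adj x y)
    (hx : 2 < T.degree x) (hy : 2 < T.degree y) : ¬ IsLongTail T a b c d := by
  intro h
  have hdeg : ∀ q, T.Adj x q → 2 ≤ T.degree q := by
    intro q hq
    by_contra! hq2
    have hpos := hq.degree_pos_right
    exact hx.not_ge (h.toIsTail.degree_le_two_of_isMaxAziTree hT (by omega) hq.symm)
  have hx' : x ∉ ({a, b, c, d} : Set V) := by
    have := h.degree_a; have := h.degree_b; have := h.degree_c; have := h.degree_d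
    grind
  have hslide := h.azi_add_le_azi_slide hx' hxy hdeg
  have hmax := hT.2 _ (h.isTree_slide hT.1 (x := x) (by grind) (by grind))
  have hlt : aziWeight (T.degree x) (T.degree y) < aziWeight (T.degree x + 1) (T.degree y) :=
    aziWeight_lt_aziWeight (mod_cast hxy.degree_pos_left) (lt_add_one _) (mod_cast hy)
  linarith

end Tail

section LowerBound

section PathGraph

variable {n : ℕ}

theorem isTree_pathGraph (n : ℕ) : (pathGraph (n + 1)).IsTree := by
  have hsub : (pathGraph (n + 1)).edgeFinset ⊆
      Finset.univ.image fun i : Fin n => s(i.castSucc, i.succ) := by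
    intro e he
    induction e with | h u v => ?_
    rw [mem_edgeFinset, mem_edgeSet, pathGraph_adj] at he
    rw [Finset.mem_image]
    rcases he with h | h
    · exact ⟨⟨u, by omega⟩, Finset.mem_univ _, Sym2.eq_iff.2 (.inl ⟨rfl, Fin.ext h⟩)⟩
    · exact ⟨⟨v, by omega⟩, Finset.mem_univ _, Sym2.eq_iff.2 (.inr ⟨rfl, Fin.ext h⟩)⟩
  have hle := (Finset.card_le_card hsub).trans Finset.card_image_le
  have hge := (pathGraph_connected n).card_vert_le_card_edgeSet_add_one
  rw [Finset.card_univ, Fintype.card_fin, edgeFinset_card, ← Nat.card_eq_fintype_card] at hle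
  refine isTree_iff_connected_and_card.2 ⟨pathGraph_connected n, hge.antisymm' ?_⟩
  simpa using hle

theorem degree_pathGraph_of_inner (i : Fin n) (h0 : i.val ≠ 0) (hi : i.val + 1 < n)
    [Fintype ((pathGraph n).neighborSet i)] : (pathGraph n).degree i = 2 := by
  have hN : (pathGraph n).neighborFinset i = {⟨i - 1, by omega⟩, ⟨i + 1, hi⟩} := by
    ext j
    simp only [mem_neighborFinset, pathGraph_adj, Finset.mem_insert, Finset.mem_singleton,
      Fin.ext_iff]
    omega
  rw [← card_neighborFinset_eq_degree, hN, Finset.card_pair (by simp [Fin.ext_iff])]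

theorem degree_pathGraph_of_end (i : Fin n) (hn : 2 ≤ n) (hi : i.val = 0 ∨ i.val + 1 = n)
    [Fintype ((pathGraph n).neighborSet i)] : (pathGraph n).degree i = 1 := by
  have hN : (pathGraph n).neighborFinset i =
      {⟨if i.val = 0 then 1 else i - 1, by split_ifs <;> omega⟩} := by
    ext j
    simp only [mem_neighborFinset, pathGraph_adj, Finset.mem_singleton, Fin.ext_iff]
    split_ifs <;> omega
  rw [← card_neighborFinset_eq_degree, hN, Finset.card_singleton]

end PathGraph

section TreeSum

variable {V : Type*} [Fintype V] {T : SimpleGraph V}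

theorem azi_le_of_forall_adj_degree_le_two (hT : T.IsTree)
    (h : ∀ p q, T.Adj p q → T.degree p ≤ 2 ∨ T.degree q ≤ 2) :
    azi T ≤ (Fintype.card V - 1) * 8 := by
  rw [azi_eq_sum_edgeWeight, ← hT.card_edgeFinset, Nat.cast_add_one, add_sub_cancel_right,
    ← nsmul_eq_mul]
  refine Finset.sum_le_card_nsmul _ _ _ fun e he => ?_
  induction e with | h p q => ?_
  rw [mem_edgeFinset, mem_edgeSet] at he
  rw [edgeWeight_mk]
  rcases h p q he with hp | hq
  · exact aziWeight_degree_le_eight he hp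
  · rw [aziWeight_comm]
    exact aziWeight_degree_le_eight he.symm hq

theorem azi_eq_of_forall_adj_degree_eq_two (hT : T.IsTree)
    (h : ∀ p q, T.Adj p q → T.degree p = 2 ∨ T.degree q = 2) :
    azi T = (Fintype.card V - 1) * 8 := by
  rw [azi_eq_sum_edgeWeight, ← hT.card_edgeFinset, Nat.cast_add_one, add_sub_cancel_right,
    ← nsmul_eq_mul]
  refine Finset.sum_eq_card_nsmul fun e he => ?_
  induction e with | h p q => ?_
  rw [mem_edgeFinset, mem_edgeSet] at he
  exact (h p q he).elim (aziWeight_degree_two_left he) (aziWeight_degree_two_right he)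

theorem azi_eq_of_iso {W : Type*} [Fintype W] {G : SimpleGraph V} {H : SimpleGraph W}
    (f : G ≃g H) : azi G = azi H := by
  rw [azi_eq_sum_edgeWeight, azi_eq_sum_edgeWeight]
  refine Finset.sum_nbij' (Sym2.map f) (Sym2.map f.symm) ?_ ?_ ?_ ?_ ?_
  all_goals
    intro e he
    induction e with | h p q => ?_
  · simpa [f.map_adj_iff] using he
  · simpa [f.symm.map_adj_iff] using he
  · simp
  · simp
  · simp [edgeWeight_mk]

theorem IsLongTail.slide {G : SimpleGraph V} {a b c d p q r : V} (h : IsLongTail G a b c d)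
    (hpq : G.Adj p q) (hpr : p ≠ r) (hpr' : ¬ G.Adj p r) (hq : q ∉ ({a, b, c, d} : Set V))
    (hr : r ∉ ({a, b, c, d} : Set V)) : IsLongTail (slide G p q r) a b c d := by
  have hd {v : V} (hvq : v ≠ q) (hvr : v ≠ r) := degree_slide_of_ne hpq hpr hpr' hvq hvr
  have hadj : ∀ {u v}, G.Adj u v → q ≠ u → q ≠ v → (AugmentedZagreb.slide G p q r).Adj u v :=
    fun huv hu hv => slide_adj.2 (.inl ⟨huv, by grind⟩)
  refine ⟨⟨hadj h.adj_ab ?_ ?_, hadj h.adj_bc ?_ ?_, (hd ?_ ?_).trans h.degree_a,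
    (hd ?_ ?_).trans h.degree_b, (hd ?_ ?_).trans h.degree_c⟩, hadj h.adj_cd ?_ ?_, h.b_ne_d,
    (hd ?_ ?_).trans h.degree_d⟩
  all_goals grind

-- The tails are regrafted at `x` and at `y`, which turns `xy` into an edge between two branching
-- vertices; the first move does not decrease the index, the second one increases it.
theorem exists_isTree_azi_lt_of_isLongTail {a b c d x y a' b' c' d' : V} (hT : T.IsTree)
    (h : IsLongTail T a b c d) (h' : IsLongTail T a' b' c' d')
    (hne : [a, b, c, d, x, y, a', b', c', d'].Nodup) (hxy : T.Adj x y)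
    (hx : ∀ q, T.Adj x q → 2 ≤ T.degree q) (hy : ∀ q, T.Adj y q → 2 ≤ T.degree q) :
    ∃ T' : SimpleGraph V, T'.IsTree ∧ azi T < azi T' := by
  simp only [List.nodup_cons, List.mem_cons, List.not_mem_nil, or_false, not_or] at hne
  have hxT : x ∉ ({a, b, c, d} : Set V) := by grind
  have hbx : b ≠ x := by grind
  have hbx' : ¬ T.Adj b x := fun hbx => by grind [h.eq_or_eq_of_adj_b hbx]
  have hcy : ¬ T.Adj c y := fun hcy => by grind [h.eq_or_eq_of_adj_c hcy]
  have hd {v : V} (hvc : v ≠ c) (hvx : v ≠ x) := degree_slide_of_ne h.adj_bc hbx hbx' hvc hvx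
  have hdx := degree_slide_new h.adj_bc hbx hbx'
  have hT₁ : (slide T b c x).IsTree := h.isTree_slide hT (by grind) (by grind)
  have h₁ : IsLongTail (slide T b c x) a' b' c' d' :=
    h'.slide h.adj_bc hbx hbx' (by grind) (by grind)
  have hyx : (slide T b c x).Adj y x := slide_adj.2 (.inl ⟨hxy.symm, by grind⟩)
  have hy₁ : ∀ q, (slide T b c x).Adj y q → 2 ≤ (slide T b c x).degree q := by
    intro q hq
    have hyq : T.Adj y q := by grind [slide_adj]
    by_cases hqx : q = x
    · rw [hqx, hdx]
      exact (hy x hxy.symm).trans (Nat.le_succ _)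
    · rw [hd (by rintro rfl; exact hcy hyq.symm) hqx]
      exact hy q hyq
  refine ⟨_, h₁.isTree_slide hT₁ (x := y) (by grind) (by grind), ?_⟩
  have hle := h.azi_add_le_azi_slide hxT hxy hx
  have hle₁ := h₁.azi_add_le_azi_slide (x := y) (y := x) (by grind) hyx hy₁
  rw [hdx, hd (by grind) hxy.ne', Nat.cast_add_one] at hle₁
  have hx2 : (2 : ℝ) ≤ T.degree x := mod_cast hy x hxy.symm
  have hy2 : (2 : ℝ) ≤ T.degree y := mod_cast hx y hxy
  have hwx : aziWeight (T.degree x) (T.degree y) ≤ aziWeight (T.degree x + 1) (T.degree y) :=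
    aziWeight_le_aziWeight (by linarith) (by linarith) hy2
  have hwy : aziWeight (T.degree y) (T.degree x + 1) <
      aziWeight (T.degree y + 1) (T.degree x + 1) :=
    aziWeight_lt_aziWeight (by linarith) (by linarith) (by linarith)
  linarith

end TreeSum

theorem exists_isTree_fin_lt_azi {n : ℕ} (hn : 10 ≤ n) :
    ∃ T : SimpleGraph (Fin n), T.IsTree ∧ (n - 1) * 8 < azi T := by
  obtain ⟨m, rfl⟩ : ∃ m, n = m + 1 := ⟨n - 1, by omega⟩
  have hP := isTree_pathGraph m
  have hinner : ∀ i : Fin (m + 1), i.val ≠ 0 → i.val + 1 < m + 1 →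
      (pathGraph (m + 1)).degree i = 2 := fun i h0 hi => degree_pathGraph_of_inner i h0 hi
  have hazi := azi_eq_of_forall_adj_degree_eq_two hP fun p q hpq => by
    rw [pathGraph_adj] at hpq
    by_cases hp : p.val ≠ 0 ∧ p.val + 1 < m + 1
    · exact .inl (hinner p hp.1 hp.2)
    · exact .inr (hinner q (by omega) (by omega))
  have hfront : IsLongTail (pathGraph (m + 1)) ⟨0, by omega⟩ ⟨1, by omega⟩ ⟨2, by omega⟩
      ⟨3, by omega⟩ := by
    refine ⟨⟨?_, ?_, degree_pathGraph_of_end _ ?_ ?_, hinner _ ?_ ?_, hinner _ ?_ ?_⟩, ?_, ?_,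
      hinner _ ?_ ?_⟩
    all_goals grind [pathGraph_adj]
  have hback : IsLongTail (pathGraph (m + 1)) ⟨m, by omega⟩ ⟨m - 1, by omega⟩ ⟨m - 2, by omega⟩
      ⟨m - 3, by omega⟩ := by
    refine ⟨⟨?_, ?_, degree_pathGraph_of_end _ ?_ ?_, hinner _ ?_ ?_, hinner _ ?_ ?_⟩, ?_, ?_,
      hinner _ ?_ ?_⟩
    all_goals grind [pathGraph_adj]
  have hmove := exists_isTree_azi_lt_of_isLongTail (x := ⟨4, by omega⟩)
    (y := ⟨5, by omega⟩) hP hfront hback ?_ ?_ ?_ ?_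
  · rw [hazi, Fintype.card_fin] at hmove
    exact hmove
  · simp only [List.nodup_cons, List.mem_cons, List.not_mem_nil, or_false, not_or,
      not_false_eq_true, List.nodup_nil, and_true, Fin.mk.injEq]
    omega
  · simp [pathGraph_adj]
  all_goals
    intro q hq
    rw [pathGraph_adj] at hq
    exact (hinner q (by grind) (by grind)).ge

theorem exists_isTree_lt_azi {V : Type*} [Fintype V] (hn : 10 ≤ Fintype.card V) :
    ∃ T : SimpleGraph V, T.IsTree ∧ (Fintype.card V - 1) * 8 < azi T := by
  obtain ⟨T, hT, hlt⟩ := exists_isTree_fin_lt_azi hn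
  let f := Iso.comap (Fintype.equivFin V) T
  exact ⟨_, f.isTree_iff.2 hT, by rwa [azi_eq_of_iso f]⟩

theorem exists_adj_two_lt_degree {V : Type*} [Fintype V] {T : SimpleGraph V}
    (hn : 10 ≤ Fintype.card V) (hT : T.IsMaxAziTree) :
    ∃ x y, T.Adj x y ∧ 2 < T.degree x ∧ 2 < T.degree y := by
  by_contra! hno
  obtain ⟨T', hT', hlt⟩ := exists_isTree_lt_azi hn
  have hle := azi_le_of_forall_adj_degree_le_two hT.1 fun p q hpq =>
    (le_or_gt (T.degree p) 2).imp_right (hno p q hpq)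
  exact ((hlt.trans_le (hT.2 T' hT')).trans_le hle).false

theorem not_isLongTail {V : Type*} [Fintype V] {T : SimpleGraph V} (hn : 10 ≤ Fintype.card V)
    (hT : T.IsMaxAziTree) (a b c d : V) : ¬ IsLongTail T a b c d := by
  obtain ⟨x, y, hxy, hx, hy⟩ := exists_adj_two_lt_degree hn hT
  exact not_isLongTail_of_adj hT hxy hx hy

end LowerBound

section InternalPath

variable {V : Type*} [Fintype V] {T : SimpleGraph V} {b c u w z : V}

theorem degree_slide_slide_of_ne (hub : T.Adj u b) (hcw : T.Adj c w) (huw : u ≠ w)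
    (huw' : ¬ T.Adj u w) (hcu : c ≠ u) (hzu : z ≠ u) (hcz : c ≠ z) (hcz' : ¬ T.Adj c z) {v : V}
    (hvb : v ≠ b) (hvz : v ≠ z) : (slide (slide T u b w) c w z).degree v = T.degree v := by
  have hcw₁ : (slide T u b w).Adj c w := (slide_adj_of_ne hcu huw.symm).2 hcw
  have hcz₁ : ¬ (slide T u b w).Adj c z := mt (slide_adj_of_ne hcu hzu).1 hcz'
  by_cases hvw : v = w
  · subst hvw
    have h₁ := degree_slide_new hub huw huw'
    have h₂ := degree_slide_old_add_one hcw₁ hcz hcz₁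
    omega
  · rw [degree_slide_of_ne hcw₁ hcz hcz₁ hvw hvz, degree_slide_of_ne hub huw huw' hvb hvw]

theorem degree_slide_slide_new (hub : T.Adj u b) (hcw : T.Adj c w) (huw : u ≠ w)
    (huw' : ¬ T.Adj u w) (hcu : c ≠ u) (hzu : z ≠ u) (hcz : c ≠ z) (hcz' : ¬ T.Adj c z)
    (hzb : z ≠ b) (hzw : z ≠ w) :
    (slide (slide T u b w) c w z).degree z = T.degree z + 1 := by
  rw [degree_slide_new ((slide_adj_of_ne hcu huw.symm).2 hcw) hcz
    (mt (slide_adj_of_ne hcu hzu).1 hcz'), degree_slide_of_ne hub huw huw' hzb hzw]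

theorem edgeFinset_slide_slide (huw : u ≠ w) (hcu : c ≠ u) (hcz : c ≠ z) :
    (slide (slide T u b w) c w z).edgeFinset =
      T.edgeFinset \ {s(u, b), s(c, w)} ∪ {s(u, w), s(c, z)} := by
  have hne : s(u, w) ≠ s(c, w) := by rwa [ne_eq, Sym2.congr_left, eq_comm]
  rw [edgeFinset_slide hcz, edgeFinset_slide huw]
  ext e
  simp only [Finset.mem_union, Finset.mem_sdiff, Finset.mem_insert, Finset.mem_singleton]
  grind

theorem azi_lt_azi_slide_slide (hub : T.Adj u b) (hcw : T.Adj c w) (huw : u ≠ w)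
    (huw' : ¬ T.Adj u w) (hcz' : ¬ T.Adj c z) (hu : 2 < T.degree u) (hw : 2 < T.degree w)
    (hb : T.degree b = 2) (hc : T.degree c = 2) (hz : T.degree z = 1)
    (hq : ∀ q, T.Adj b q → s(b, q) ≠ s(u, b) → s(b, q) ≠ s(c, w) → T.degree q = 2) :
    azi T < azi (slide (slide T u b w) c w z) := by
  set T' := slide (slide T u b w) c w z with hT'
  have hcz : c ≠ z := by grind
  have hcu : c ≠ u := by grind
  have hzu : z ≠ u := by grind
  have hd {v : V} (hvb : v ≠ b) (hvz : v ≠ z) : T'.degree v = T.degree v :=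
    degree_slide_slide_of_ne hub hcw huw huw' hcu hzu hcz hcz' hvb hvz
  have hE := edgeFinset_slide_slide (T := T) (b := b) huw hcu hcz
  have hkept {p q : V} (hpq : T.Adj p q) (hA : s(p, q) ∉ ({s(u, b), s(c, w)} : Finset _)) :
      T'.Adj p q := by
    rw [← mem_edgeSet, ← mem_edgeFinset, hE]
    exact Finset.mem_union_left _ (Finset.mem_sdiff.2 ⟨mem_edgeFinset.2 hpq, hA⟩)
  have hcz₁ : T'.Adj c z := slide_adj.2 (.inr ⟨rfl, hcz⟩)
  have hdz : T'.degree z = 2 := by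
    rw [degree_slide_slide_new hub hcw huw huw' hcu hzu hcz hcz' (by grind) (by grind), hz]
  have h := azi_add_sum_le (G := T) (G' := T') (A := {s(u, b), s(c, w)})
    (B := {s(u, w), s(c, z)}) ?_ ?_ hE ?_
  · rw [Finset.sum_pair (by simp [hcu.symm, hzu.symm]),
      Finset.sum_pair (by simp [hcu.symm, huw])] at h
    simp only [edgeWeight_mk] at h
    rw [aziWeight_degree_two_right hub hb, aziWeight_degree_two_left hcw hc,
      aziWeight_degree_two_right hcz₁ hdz, hd hub.ne (by grind), hd (by grind) (by grind)] at h
    have hgain : 8 < aziWeight (T.degree u) (T.degree w) :=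
      eight_lt_aziWeight (mod_cast hu) (mod_cast hw)
    linarith
  · simp [Finset.insert_subset_iff, hub, hcw]
  · simp [huw', hcz']
  · intro p q hpq hA hne
    have hpq' := hkept hpq hA
    have hp : p = b ∨ p = z := by
      by_contra! hp
      exact hne (hd hp.1 hp.2)
    rcases hp with rfl | rfl
    · have hq2 : T.degree q = 2 := hq q hpq (by grind) (by grind)
      have hq2' : T'.degree q = 2 := by rw [hd hpq.ne' (by grind), hq2]
      rw [aziWeight_degree_two_right hpq hq2, aziWeight_degree_two_right hpq' hq2']
    · rw [aziWeight_degree_two_left hpq' hdz]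
      exact aziWeight_degree_le_eight hpq (by omega)

theorem eq_or_eq_of_adj_getVert {p : T.Walk u w} (hp : IsInternalPath p) {i : ℕ} (h0 : 0 < i)
    (hi : i < p.length) {q : V} (hq : T.Adj (p.getVert i) q) :
    q = p.getVert (i - 1) ∨ q = p.getVert (i + 1) := by
  refine eq_or_eq_of_adj_of_degree_eq_two (hp.2.2.2 i h0 hi) ?_ (p.adj_getVert_succ hi) ?_ hq
  · have := p.adj_getVert_succ (i := i - 1) (by omega)
    rw [Nat.sub_add_cancel h0] at this
    exact this.symm
  · intro heq
    have := hp.1.getVert_injOn (by grind) (by grind) heq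
    omega

theorem two_le_degree_getVert {p : T.Walk u w} (hp : IsInternalPath p) (i : ℕ) :
    2 ≤ T.degree (p.getVert i) := by
  obtain ⟨-, hu, hw, hinner⟩ := hp
  rcases Nat.eq_zero_or_pos i with rfl | hi0
  · exact p.getVert_zero.symm ▸ hu.le
  rcases lt_or_ge i p.length with hil | hil
  · exact (hinner i hi0 hil).ge
  · exact (p.getVert_of_length_le hil).symm ▸ hw.le

theorem isTree_slide_slide_of_isInternalPath (hT : T.IsTree) {p : T.Walk u w}
    (hp : IsInternalPath p) (hl : 2 ≤ p.length) (hz : T.degree z = 1) :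
    (slide (slide T u p.snd w) p.penultimate w z).IsTree := by
  obtain ⟨hpath, hu, hw, hinner⟩ := id hp
  have hnil : ¬ p.Nil := by rw [Walk.not_nil_iff_lt_length]; omega
  have hT₁ := isTree_slide hT (p.adj_snd hnil) (reachable_deleteEdges_snd hpath hnil)
  have hcu : p.penultimate ≠ u := fun h => by
    have := hinner (p.length - 1) (by omega) (by omega)
    rw [← Walk.penultimate, h] at this
    omega
  have hwu : w ≠ u := by rintro rfl; exact hnil (Walk.isPath_iff_nil.1 hpath)
  refine isTree_slide hT₁ ((slide_adj_of_ne hcu hwu).2 (p.adj_penultimate hnil))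
    (reachable_deleteEdges_of_cut hT₁.connected
      {x | ∃ i, 0 < i ∧ i < p.length ∧ p.getVert i = x} ?_
      ⟨p.length - 1, by omega, by omega, rfl⟩ ?_)
  · rintro _ ⟨i, hi0, hil, rfl⟩ q hq hadj
    have hi := hinner i hi0 hil
    rcases slide_adj.1 hadj with ⟨hadj, hne⟩ | ⟨heq, -⟩
    · rcases eq_or_eq_of_adj_getVert hp hi0 hil hadj with rfl | rfl
      · obtain rfl : i = 1 := by
          by_contra! hi1
          exact hq ⟨i - 1, by omega, by omega, rfl⟩
        simp at hne
      · obtain hil' : i + 1 = p.length := by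
          by_contra! hil'
          exact hq ⟨i + 1, by omega, by omega, rfl⟩
        exact ⟨by rw [Walk.penultimate, ← hil', Nat.add_sub_cancel],
          by rw [hil', p.getVert_length]⟩
    · grind
  · rintro ⟨i, hi0, hil, rfl⟩
    have := hinner i hi0 hil
    omega

theorem length_lt_two_of_isInternalPath (hT : T.IsMaxAziTree) {p : T.Walk u w}
    (hp : IsInternalPath p) : p.length < 2 := by
  by_contra! hl
  obtain ⟨hpath, hu, hw, hinner⟩ := id hp
  have hnil : ¬ p.Nil := by rw [Walk.not_nil_iff_lt_length]; omega
  have hb : T.degree p.snd = 2 := hinner 1 one_pos (by omega)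
  have hc : T.degree p.penultimate = 2 := hinner (p.length - 1) (by omega) (by omega)
  have huw : u ≠ w := by rintro rfl; exact hnil (Walk.isPath_iff_nil.1 hpath)
  have huw' : ¬ T.Adj u w := not_adj_of_reachable_deleteEdges hT.1.isAcyclic (p.adj_snd hnil)
    (by grind) (reachable_deleteEdges_snd hpath hnil)
  have : Nontrivial V := ⟨u, w, huw⟩
  obtain ⟨z, hz⟩ := hT.1.exists_vert_degree_one_of_nontrivial
  have hcz : ¬ T.Adj p.penultimate z := by
    intro hcz
    rcases eq_or_eq_of_adj_getVert hp (by omega) (by omega) hcz with rfl | rfl <;>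
      exact (two_le_degree_getVert hp _).not_gt (hz.trans_lt one_lt_two)
  have hlt := azi_lt_azi_slide_slide (p.adj_snd hnil) (p.adj_penultimate hnil) huw huw' hcz hu hw
    hb hc hz ?_
  · exact hlt.not_ge (hT.2 _ (isTree_slide_slide_of_isInternalPath hT.1 hp hl hz))
  · intro q hq hqu hqw
    rcases eq_or_eq_of_adj_getVert hp one_pos (by omega) hq with rfl | rfl
    · simp at hqu
    · refine hinner 2 two_pos (lt_of_le_of_ne hl fun h => hqw ?_)
      rw [Walk.penultimate, ← h, p.getVert_of_length_le h.ge]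
end InternalPath

section PendentPath

variable {V : Type*} [Fintype V] {T : SimpleGraph V} {u v u' v' : V}

theorem isPendentPath_reverse {p : T.Walk u v} (hp : IsPendentPath p) :
    IsPendentPath p.reverse := by
  refine ⟨hp.1.reverse, hp.2.1.symm.imp And.symm And.symm, fun i h0 hi => ?_⟩
  rw [Walk.length_reverse] at hi
  rw [Walk.getVert_reverse]
  exact hp.2.2 _ (by omega) (by omega)

theorem isTail_of_isPendentPath {p : T.Walk u v} (hp : IsPendentPath p) (hu : T.degree u = 1)
    (hl : 3 ≤ p.length) : IsTail T u (p.getVert 1) (p.getVert 2) where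
  adj_ab := p.adj_snd (by rw [Walk.not_nil_iff_lt_length]; omega)
  adj_bc := p.adj_getVert_succ (by omega)
  degree_a := hu
  degree_b := hp.2.2 1 (by omega) (by omega)
  degree_c := hp.2.2 2 (by omega) (by omega)

theorem length_lt_four_of_isPendentPath (hn : 10 ≤ Fintype.card V) (hT : T.IsMaxAziTree)
    {p : T.Walk u v} (hp : IsPendentPath p) : p.length < 4 := by
  wlog hu : T.degree u = 1 generalizing u v p
  · rw [← Walk.length_reverse]
    exact this (isPendentPath_reverse hp) (hp.2.1.resolve_left fun h => hu h.1).2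
  by_contra! hl
  refine not_isLongTail hn hT _ _ _ (p.getVert 3)
    { isTail_of_isPendentPath hp hu (by omega) with
      adj_cd := p.adj_getVert_succ (by omega)
      degree_d := hp.2.2 3 (by omega) (by omega)
      b_ne_d := fun h => ?_ }
  have := hp.1.getVert_injOn (by grind) (by grind) h
  omega

theorem getVert_eq_of_isPath {p : T.Walk u v} {q : T.Walk u v'} (hp : p.IsPath) (hq : q.IsPath)
    (hu : T.degree u = 1) (hinner : ∀ i, 0 < i → i < p.length → T.degree (p.getVert i) = 2) {i : ℕ}
    (hip : i ≤ p.length) (hiq : i ≤ q.length) : p.getVert i = q.getVert i := by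
  induction i using Nat.strong_induction_on with | h i ih => ?_
  rcases i with - | - | i
  · rw [p.getVert_zero, q.getVert_zero]
  · have hadj₁ := p.adj_getVert_succ (i := 0) (by omega)
    have hadj₂ := q.adj_getVert_succ (i := 0) (by omega)
    rw [Walk.getVert_zero] at hadj₁ hadj₂
    exact eq_of_adj_of_degree_eq_one hu hadj₂ hadj₁
  · have h₀ := ih i (by omega) (by omega) (by omega)
    have h₁ := ih (i + 1) (by omega) (by omega) (by omega)
    have hne {r : V} {s : T.Walk u r} (hs : s.IsPath) (hi : i + 2 ≤ s.length) :
        s.getVert i ≠ s.getVert (i + 2) := fun h => by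
      have := hs.getVert_injOn (by grind) (by grind) h
      omega
    have hadj := p.adj_getVert_succ (i := i) (by omega)
    have hadjp := p.adj_getVert_succ (i := i + 1) (by omega)
    have hadjq := q.adj_getVert_succ (i := i + 1) (by omega)
    rw [← h₁] at hadjq
    exact ((eq_or_eq_of_adj_of_degree_eq_two (hinner (i + 1) (by omega) (by omega)) hadj.symm hadjp
      (hne hp hip) hadjq).resolve_left fun h => hne hq hiq (h₀ ▸ h.symm)).symm

theorem isLongTail_slide {a b c b' c' y : V} (h : IsTail T a b c) (h' : IsTail T y b' c')
    (hya : y ≠ a) (hc : c' ≠ b) : IsLongTail (slide T a b y) a y b' c' := by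
  have hyb : y ≠ b := fun e => absurd (h'.degree_a.symm.trans (e ▸ h.degree_b)) (by decide)
  have hyc : y ≠ c := fun e => absurd (h'.degree_a.symm.trans (e ▸ h.degree_c)) (by decide)
  have hab' : a ≠ b' := fun e => absurd (h.degree_a.symm.trans (e ▸ h'.degree_b)) (by decide)
  have hac' : a ≠ c' := fun e => absurd (h.degree_a.symm.trans (e ▸ h'.degree_c)) (by decide)
  have hb : b' ≠ b := by
    rintro rfl
    exact (h.eq_or_eq_of_adj_b h'.adj_ab.symm).elim hya hyc
  have hay : ¬ T.Adj a y := fun hay => hyb (h.eq_of_adj_a hay)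
  have hd {v : V} (hvb : v ≠ b) (hvy : v ≠ y) := degree_slide_of_ne h.adj_ab hya.symm hay hvb hvy
  exact
    { adj_ab := slide_adj.2 (.inr ⟨rfl, hya.symm⟩)
      adj_bc := (slide_adj_of_ne hya hab'.symm).2 h'.adj_ab
      adj_cd := (slide_adj_of_ne hab'.symm hac'.symm).2 h'.adj_bc
      b_ne_d := h'.a_ne_c
      degree_a := by rw [hd h.adj_ab.ne hya.symm, h.degree_a]
      degree_b := by rw [degree_slide_new h.adj_ab hya.symm hay, h'.degree_a]
      degree_c := by rw [hd hb h'.adj_ab.ne', h'.degree_b]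
      degree_d := by rw [hd hc h'.a_ne_c.symm, h'.degree_c] }

theorem eq_of_isPendentPath (hn : 10 ≤ Fintype.card V) (hT : T.IsMaxAziTree)
    {p : T.Walk u v} {q : T.Walk u' v'} (hp : IsPendentPath p) (hpl : p.length = 3)
    (hq : IsPendentPath q) (hql : q.length = 3) (hu : T.degree u = 1) (hu' : T.degree u' = 1) :
    u = u' := by
  by_contra huu
  have hpt := isTail_of_isPendentPath hp hu hpl.ge
  have hqt := isTail_of_isPendentPath hq hu' hql.ge
  refine not_isLongTail hn (hpt.isMaxAziTree_slide hT hu' (Ne.symm huu)) _ _ _ _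
    (isLongTail_slide hpt hqt (Ne.symm huu) fun h => ?_)
  have hadj : T.Adj (q.getVert 2) v' := by
    have hadj := q.adj_getVert_succ (i := 2) (by omega)
    rwa [q.getVert_of_length_le hql.le] at hadj
  have hv' : 2 < T.degree v' := (hq.2.1.resolve_right (by omega)).2
  have hb' := hqt.degree_b
  have hne : q.getVert 1 ≠ v' := by grind
  rcases eq_or_eq_of_adj_of_degree_eq_two hqt.degree_c hqt.adj_bc.symm hadj hne
    (h ▸ hpt.adj_ab.symm) with rfl | rfl <;> omega

theorem toSubgraph_eq_of_isPendentPath (hn : 10 ≤ Fintype.card V) (hT : T.IsMaxAziTree)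
    {p : T.Walk u v} {q : T.Walk u' v'} (hp : IsPendentPath p) (hpl : p.length = 3)
    (hq : IsPendentPath q) (hql : q.length = 3) : p.toSubgraph = q.toSubgraph := by
  wlog hu : T.degree u = 1 generalizing u v p
  · rw [← p.toSubgraph_reverse]
    exact this (isPendentPath_reverse hp) (p.length_reverse.trans hpl)
      (hp.2.1.resolve_left fun h => hu h.1).2
  wlog hu' : T.degree u' = 1 generalizing u' v' q
  · rw [← q.toSubgraph_reverse]
    exact this (isPendentPath_reverse hq) (q.length_reverse.trans hql)
      (hq.2.1.resolve_left fun h => hu' h.1).2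
  obtain rfl := eq_of_isPendentPath hn hT hp hpl hq hql hu hu'
  have hget {i : ℕ} (hi : i ≤ 3) : p.getVert i = q.getVert i :=
    getVert_eq_of_isPath hp.1 hq.1 hu hp.2.2 (hi.trans hpl.ge) (hi.trans hql.ge)
  obtain rfl : v = v' := by
    rw [← p.getVert_length, ← q.getVert_length, hpl, hql, hget le_rfl]
  rw [Walk.ext_getVert_le_length (hpl.trans hql.symm) fun i hi => hget (hi.trans hpl.le)]

end PendentPath

end AugmentedZagreb

theorem theorem2 {V : Type*} [Fintype V] (hn : 10 ≤ Fintype.card V)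
    (T : SimpleGraph V) (hT : T.IsMaxAziTree) :
    (∀ (u v : V) (p : T.Walk u v), SimpleGraph.IsInternalPath p → ¬ 2 ≤ p.length) ∧
    (∀ (u v : V) (p : T.Walk u v), SimpleGraph.IsPendentPath p → ¬ 4 ≤ p.length) ∧
    (∀ (u v u' v' : V) (p : T.Walk u v) (q : T.Walk u' v'),
      SimpleGraph.IsPendentPath p → p.length = 3 →
      SimpleGraph.IsPendentPath q → q.length = 3 →
      p.toSubgraph = q.toSubgraph) :=
  ⟨fun _ _ _ hp => (AugmentedZagreb.length_lt_two_of_isInternalPath hT hp).not_ge,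
    fun _ _ _ hp => (AugmentedZagreb.length_lt_four_of_isPendentPath hn hT hp).not_ge,
    fun _ _ _ _ _ _ hp hpl hq hql =>
      AugmentedZagreb.toSubgraph_eq_of_isPendentPath hn hT hp hpl hq hql⟩
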